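/- For a sequence $r_1, r_2, \ldots$ of integers and positive integers $a \le b$, let $v_{a,b} \ge 1$ denote the denominator, in lowest terms, of the rational number $\sum_{i=a}^{b} \frac{r_i}{i}$. For a positive integer $a$, let $b(a)$ be the smallest integer $b > a$ such that $v_{a,b} < v_{a,b-1}$, with $b(a) = \infty$ if no such $b$ exists. Theorem. There exists a sequence $r_1, r_2, \ldots$ with $r_i \in \{0,1\}$ for all $i \ge 1$, which is not periodic (that is, there is no $t \ge 1$ with $r_{i+t} = r_i$ for all $i \ge 1$), for which $$\liminf_{a \to \infty} \frac{b(a) - a}{\log a} = \frac12 ,$$ the lower limit being taken in the extended real numbers. -/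

import Mathlib

/-- `sumDenom r a b` is `v_{a,b}`: the positive denominator, in lowest terms, of the rational
number `∑_{i=a}^b r_i / i`. Only values `a ≥ 1` matter, so `r 0` plays no role. -/
def sumDenom (r : ℕ → ℤ) (a b : ℕ) : ℕ :=
  (∑ i ∈ Finset.Icc a b, (r i : ℚ) / (i : ℚ)).den

/-- `firstDrop r a` is `b(a)`: the smallest integer `b > a` with `v_{a,b} < v_{a,b-1}`,
as an extended natural number; it is `⊤` (that is, `∞`) if there is no such `b`. -/
noncomputable def firstDrop (r : ℕ → ℤ) (a : ℕ) : ℕ∞ :=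
  ⨅ (b : ℕ) (_ : a < b ∧ sumDenom r a b < sumDenom r a (b - 1)), (b : ℕ∞)

/-- The sequence `r_1, r_2, …` is periodic: for some `t ≥ 1`, `r_{i+t} = r_i` for all `i ≥ 1`. -/
def IsPeriodicSeq (r : ℕ → ℤ) : Prop :=
  ∃ t : ℕ, 1 ≤ t ∧ ∀ i : ℕ, 1 ≤ i → r (i + t) = r i

/-- The quotient `(b(a) - a) / log a` as an extended real number
(equal to `⊤` when `b(a) = ⊤` and `a ≥ 2`). -/
noncomputable def dropRatio (r : ℕ → ℤ) (a : ℕ) : EReal :=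
  (((firstDrop r a : ENNReal) : EReal) - (a : EReal)) / ((Real.log (a : ℝ) : ℝ) : EReal)

/-! Adding 1/b to a sum S can lower the denominator only if g = gcd(b, den S) satisfies g² > b
(`den_le_den_add_one_div`). The sequence is the indicator of sparse blocks, each designed so that
this happens at its last term b, after about (log b)/2 steps and no sooner.

A block is built from odd primes Q up to a prime K in Q, with product P about exp K. It consists of
b and of b - p for p in Q (for p = 3 the offset may be 6), where 2b is congruent to the offset mod
p². Then p divides exactly two terms, once each, and cancels from the sum of their reciprocals. When
1/b is added, P leaves the denominator and at most b/P enters; since b < P², it drops. As b is also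
at least P²/9, log b is about 2K, so a = b - K gives ratios tending to 1/2.

Conversely, from a > b - K the term b - K is missing, and gcd(b, den S) is too small for a drop at
b. At an earlier term the gcd divides lcm(1, ..., K)/P, which is too small by Chebyshev's bound on
ψ. Hence a drop within a block takes at least K steps, and K ≥ (log b)/2 because P ≤ exp K. A drop
reached across a gap takes at least a steps.

The prime number theorem is not needed: arbitrarily large K with θ(K) ≥ (1 - δ)K suffice, and
Stirling's formula provides them. -/

/-! ### Chebyshev functions and sets of primes with product about exp K -/

open Chebyshev in
theorem log_factorial_eq_sum_psi (n : ℕ) :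
    Real.log (n.factorial : ℝ) = ∑ k ∈ Finset.Ioc 0 n, ψ ((n / k : ℕ) : ℝ) := by
  have h1 : Real.log (n.factorial : ℝ) = ∑ k ∈ Finset.Ioc 0 n, ArithmeticFunction.log k := by
    induction n with
    | zero => simp
    | succ n ih =>
      rw [Finset.sum_Ioc_succ_top (by omega), ← ih, Nat.factorial_succ, Nat.cast_mul,
        Real.log_mul (by positivity) (by positivity), add_comm]
      simp [ArithmeticFunction.log_apply]
  have h := ArithmeticFunction.sum_Ioc_mul_eq_sum_sum
    ((ArithmeticFunction.zeta : ArithmeticFunction ℕ) : ArithmeticFunction ℝ)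
    ArithmeticFunction.vonMangoldt n
  rw [ArithmeticFunction.zeta_mul_vonMangoldt] at h
  rw [h1, h]
  refine Finset.sum_congr rfl fun k hk => ?_
  have hk0 : k ≠ 0 := by have := (Finset.mem_Ioc.1 hk).1; omega
  simp [Chebyshev.psi, ArithmeticFunction.natCoe_apply, hk0]

open Chebyshev in
/-- No bound `ψ n ≤ c n + C` with `c < 1` holds for all `n`. -/
theorem exists_mul_add_lt_psi {c : ℝ} (hc0 : 0 ≤ c) (hc : c < 1) (C : ℝ) :
    ∃ n : ℕ, c * n + C < ψ (n : ℝ) := by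
  by_contra! hcon
  -- Summing the assumed bound over n / k gives log n! ≤ c n log n + O(n), against n log n - n from
  -- Stirling.
  have key : ∀ n : ℕ, 1 ≤ n → (1 - c) * Real.log n ≤ c + C + 1 := by
    intro n hn
    have hn' : (0 : ℝ) < n := by exact_mod_cast hn
    have h1 := Stirling.le_log_factorial_stirling (n := n) (by omega)
    have hl : 0 ≤ Real.log n := Real.log_natCast_nonneg n
    have hpi : 0 ≤ Real.log (2 * Real.pi) :=
      Real.log_nonneg (by nlinarith [Real.pi_gt_three])
    have h2 : Real.log (n.factorial : ℝ) ≤ ∑ k ∈ Finset.Ioc 0 n, (c * n * (k : ℝ)⁻¹ + C) := by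
      rw [log_factorial_eq_sum_psi]
      refine Finset.sum_le_sum fun k hk => (hcon _).trans ?_
      have : ((n / k : ℕ) : ℝ) ≤ n / k := Nat.cast_div_le
      have := mul_le_mul_of_nonneg_left this hc0
      rw [div_eq_mul_inv, ← mul_assoc] at this
      linarith
    have h3 : ∑ k ∈ Finset.Ioc 0 n, (k : ℝ)⁻¹ ≤ 1 + Real.log n := by
      have := harmonic_le_one_add_log n
      simp_rw [harmonic_eq_sum_Icc, Rat.cast_sum, Rat.cast_inv, Rat.cast_natCast] at this
      exact this
    rw [Finset.sum_add_distrib, ← Finset.mul_sum] at h2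
    simp only [Finset.sum_const, Nat.card_Ioc, tsub_zero, nsmul_eq_mul] at h2
    have h4 := mul_le_mul_of_nonneg_left h3 (mul_nonneg hc0 hn'.le)
    have h5 : n * ((1 - c) * Real.log n) ≤ n * (c + C + 1) := by nlinarith
    exact le_of_mul_le_mul_left h5 hn'
  have ht : Filter.Tendsto (fun n : ℕ => (1 - c) * Real.log n) Filter.atTop Filter.atTop :=
    (Real.tendsto_log_atTop.comp tendsto_natCast_atTop_atTop).const_mul_atTop (by linarith)
  obtain ⟨n, hn1, hn2⟩ := ((ht.eventually_gt_atTop (c + C + 1)).and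
    (Filter.eventually_ge_atTop 1)).exists
  exact absurd (key n hn2) (not_le.2 hn1)

-- θ jumps only at primes, so failure at every prime K ≥ N would give θ(n) ≤ (1 - δ)n + O(1) for all
-- n. As ψ - θ is O(√n), this contradicts `exists_mul_add_lt_psi`.
open Chebyshev in
theorem exists_prime_mul_le_theta {δ : ℝ} (hδ : 0 < δ) (hδ1 : δ < 1) (N : ℕ) :
    ∃ K : ℕ, N ≤ K ∧ K.Prime ∧ (1 - δ) * K ≤ θ (K : ℝ) := by
  by_contra! hcon
  have h1 : ∀ n : ℕ, θ (n : ℝ) ≤ (1 - δ) * n + θ (N : ℝ) := by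
    intro n
    induction n with
    | zero => simpa using theta_nonneg _
    | succ n ih =>
      rcases lt_or_ge (n + 1) N with h | h
      · have h2 : θ ((n + 1 : ℕ) : ℝ) ≤ θ (N : ℝ) := theta_mono (by exact_mod_cast h.le)
        have : 0 ≤ (1 - δ) * ((n + 1 : ℕ) : ℝ) := mul_nonneg (by linarith) (by positivity)
        linarith
      · by_cases hp : (n + 1).Prime
        · linarith [hcon (n + 1) h hp, theta_nonneg (N : ℝ)]
        · have : θ ((n + 1 : ℕ) : ℝ) = θ (n : ℝ) := by
            simp only [Chebyshev.theta, Nat.floor_natCast]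
            rw [Finset.sum_filter, Finset.sum_filter, Finset.sum_Ioc_succ_top (by omega)]
            simp [hp]
          rw [this]
          push_cast
          linarith
  obtain ⟨A, hA⟩ := psi_sub_theta_le_mul_sqrt
  obtain ⟨n, hn⟩ := exists_mul_add_lt_psi (c := 1 - δ / 2) (by linarith) (by linarith)
    (θ (N : ℝ) + A ^ 2 / (2 * δ))
  have h2 := hA n
  have h3 := h1 n
  have h4 : A * √(n : ℝ) ≤ δ / 2 * n + A ^ 2 / (2 * δ) := by
    have hs : √(n : ℝ) ^ 2 = n := Real.sq_sqrt (by positivity)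
    have : δ / 2 * n + A ^ 2 / (2 * δ) - A * √(n : ℝ) = (δ * √(n : ℝ) - A) ^ 2 / (2 * δ) := by
      rw [← hs]
      field_simp
      rw [Real.sqrt_sq (Real.sqrt_nonneg _)]
      ring
    have h5 : 0 ≤ (δ * √(n : ℝ) - A) ^ 2 / (2 * δ) := by positivity
    linarith
  linarith

theorem Finset.exists_subset_sum_mem_Icc {ι : Type*} [DecidableEq ι] (s : Finset ι) (f : ι → ℝ)
    {M c : ℝ} (hM : 0 ≤ M) (hf : ∀ i ∈ s, f i ≤ M) (hc0 : 0 ≤ c) (hc : c ≤ ∑ i ∈ s, f i) :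
    ∃ t ⊆ s, c - M ≤ ∑ i ∈ t, f i ∧ ∑ i ∈ t, f i ≤ c := by
  induction s using Finset.induction_on with
  | empty =>
    refine ⟨∅, le_rfl, ?_, by simpa using hc0⟩
    simp only [Finset.sum_empty] at hc ⊢
    linarith
  | insert x s hx ih =>
    by_cases h : c ≤ ∑ i ∈ s, f i
    · obtain ⟨t, ht, h1⟩ := ih (fun i hi => hf i (Finset.mem_insert_of_mem hi)) h
      exact ⟨t, ht.trans (Finset.subset_insert _ _), h1⟩
    · rw [Finset.sum_insert hx] at hc
      have := hf x (Finset.mem_insert_self _ _)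
      exact ⟨s, Finset.subset_insert _ _, by linarith, by linarith⟩

open Chebyshev in
/-- There are arbitrarily large primes `K` and sets of odd primes up to `K`, containing `3` and
`K`, whose product is about `exp K`. -/
theorem exists_prime_finset {δ : ℝ} (hδ : 0 < δ) (hδ1 : δ < 1) (N : ℕ) :
    ∃ K : ℕ, N ≤ K ∧ K.Prime ∧ ∃ Q : Finset ℕ, (∀ p ∈ Q, p.Prime ∧ p ≠ 2 ∧ p ≤ K) ∧
      3 ∈ Q ∧ K ∈ Q ∧ (1 - δ) * K ≤ ∑ p ∈ Q, Real.log p ∧ ∑ p ∈ Q, Real.log p ≤ K := by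
  have hlog : ∀ᶠ n : ℕ in Filter.atTop, Real.log n ≤ δ / 16 * n := by
    have := (Real.isLittleO_log_id_atTop.comp_tendsto tendsto_natCast_atTop_atTop).bound
      (c := δ / 16) (by positivity)
    filter_upwards [this] with n hn
    simp only [Function.comp, id, Real.norm_eq_abs, Nat.abs_cast] at hn
    exact (le_abs_self _).trans hn
  obtain ⟨N', hN'⟩ := Filter.eventually_atTop.1 hlog
  obtain ⟨K, hK, hKp, hθ⟩ := exists_prime_mul_le_theta (δ := δ / 4) (by linarith) (by linarith)
    (max (max N N') 5)
  have hK5 : 5 ≤ K := (le_max_right _ _).trans hK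
  have hlK := hN' K ((le_max_right _ _).trans ((le_max_left _ _).trans hK))
  have hK0 : (0 : ℝ) < K := by exact_mod_cast hKp.pos
  have hle : ∀ m : ℕ, 1 ≤ m → m ≤ K → Real.log m ≤ Real.log K := fun m hm h =>
    Real.log_le_log (by exact_mod_cast hm) (by exact_mod_cast h)
  set s : Finset ℕ := (((Finset.Ioc 0 K).filter Nat.Prime).erase 2).erase 3 |>.erase K with hs
  have hmem : ∀ p ∈ s, p.Prime ∧ p ≠ 2 ∧ p ≠ 3 ∧ p ≠ K ∧ p ≤ K := by
    intro p hp
    simp only [hs, Finset.mem_erase, Finset.mem_filter, Finset.mem_Ioc] at hp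
    tauto
  have hsum : θ (K : ℝ) = ∑ p ∈ s, Real.log p + Real.log K + Real.log (3 : ℕ) + Real.log (2 : ℕ) := by
    rw [Chebyshev.theta, Nat.floor_natCast, hs, Finset.sum_erase_add, Finset.sum_erase_add,
      Finset.sum_erase_add]
    · simp [Nat.prime_two]; omega
    · simp [Nat.prime_three]; omega
    · simp only [Finset.mem_erase, Finset.mem_filter, Finset.mem_Ioc]
      exact ⟨by omega, by omega, ⟨by omega, le_rfl⟩, hKp⟩
  have h2 := hle 2 (by omega) (by omega)
  have h3 := hle 3 (by omega) (by omega)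
  have hl3 : 0 ≤ Real.log (3 : ℕ) := Real.log_natCast_nonneg _
  have hl2 : 0 ≤ Real.log (2 : ℕ) := Real.log_natCast_nonneg _
  -- θ(K) may exceed K, so primes are discarded. The target (1 - δ/2)K leaves room below K for log 3
  -- + log K, and overshoot costs at most log K.
  obtain ⟨t, hts, ht1, ht2⟩ := s.exists_subset_sum_mem_Icc (fun p => Real.log p)
    (M := Real.log K) (c := (1 - δ / 2) * K) (by linarith)
    (fun p hp => hle p (hmem p hp).1.one_le (hmem p hp).2.2.2.2)
    (mul_nonneg (by linarith) hK0.le) (by nlinarith)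
  have ht3 : 3 ∉ t := fun h => (hmem _ (hts h)).2.2.1 rfl
  have htK : K ∉ t := fun h => (hmem _ (hts h)).2.2.2.1 rfl
  have hsum' : ∑ p ∈ insert 3 (insert K t), Real.log (p : ℝ)
      = Real.log (3 : ℕ) + (Real.log K + ∑ p ∈ t, Real.log (p : ℝ)) := by
    rw [Finset.sum_insert, Finset.sum_insert htK]
    simp only [Finset.mem_insert, not_or]
    exact ⟨by omega, ht3⟩
  refine ⟨K, ((le_max_left _ _).trans (le_max_left _ _)).trans hK, hKp, insert 3 (insert K t),
    ?_, by simp, by simp, ?_, ?_⟩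
  · intro p hp
    simp only [Finset.mem_insert] at hp
    rcases hp with rfl | rfl | hp
    · exact ⟨Nat.prime_three, by omega, by omega⟩
    · exact ⟨hKp, by omega, le_rfl⟩
    · exact ⟨(hmem p (hts hp)).1, (hmem p (hts hp)).2.1, (hmem p (hts hp)).2.2.2.2⟩
  · rw [hsum']; nlinarith
  · rw [hsum']; nlinarith

/-! ### Denominators of sums of unit fractions -/

/-- With b = b₁d, den S = v₁d and d the gcd, the new numerator over d b₁ v₁ is coprime to b₁v₁. So
only factors of d can cancel, and b₁v₁ ≥ d v₁ once d ≤ b₁. -/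
theorem den_le_den_add_one_div (S : ℚ) {b : ℕ} (hb : 0 < b) (h : (b.gcd S.den) ^ 2 ≤ b) :
    S.den ≤ (S + 1 / (b : ℚ)).den := by
  obtain ⟨d, b₁, v₁, hd, hco, hb₁, hv₁⟩ := Nat.exists_coprime' (m := b) (n := S.den)
    (Nat.gcd_pos_of_pos_left _ hb)
  have hdg : b.gcd S.den = d := by
    rw [hb₁, hv₁, Nat.gcd_mul_right, hco.gcd_eq_one, one_mul]
  rw [hdg] at h
  set T := S + 1 / (b : ℚ) with hT
  have hvpos : 0 < v₁ := Nat.pos_of_mul_pos_right (hv₁ ▸ S.den_pos)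
  have hbpos : 0 < b₁ := Nat.pos_of_mul_pos_right (hb₁ ▸ hb)
  have hb₁' : (b : ℚ) = b₁ * d := by exact_mod_cast hb₁
  have hv₁' : (S.den : ℚ) = v₁ * d := by exact_mod_cast hv₁
  have hq : (T.num : ℚ) * (d * b₁ * v₁) = (S.num * b₁ + v₁) * T.den := by
    have h1 : (T.num : ℚ) = T * T.den := (Rat.mul_den_eq_num T).symm
    have h2 : (S.num : ℚ) = S * S.den := (Rat.mul_den_eq_num S).symm
    have : (d : ℚ) ≠ 0 := by positivity
    have : (b₁ : ℚ) ≠ 0 := by positivity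
    rw [h1, h2, hv₁', hT, hb₁']
    field_simp
  have hz : T.num * (d * b₁ * v₁) = (S.num * b₁ + v₁) * T.den := by exact_mod_cast hq
  have hcop : IsCoprime ((b₁ * v₁ : ℤ)) (S.num * b₁ + v₁) := by
    have e1 : IsCoprime (b₁ : ℤ) (v₁ : ℤ) := Nat.isCoprime_iff_coprime.2 hco
    have e2 : IsCoprime (v₁ : ℤ) S.num := by
      have : IsCoprime S.num (S.den : ℤ) := Rat.isCoprime_num_den S
      rw [hv₁, Nat.cast_mul] at this
      exact this.of_mul_right_left.symm
    refine IsCoprime.mul_left ?_ ?_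
    · simpa [add_comm, mul_comm] using e1.add_mul_left_right S.num
    · simpa using (e2.mul_right e1.symm).add_mul_left_right 1
  have hdvd : (b₁ * v₁ : ℤ) ∣ T.den := by
    refine hcop.dvd_of_dvd_mul_left ?_
    rw [← hz]
    exact ⟨T.num * d, by ring⟩
  have hle : b₁ * v₁ ≤ T.den := Nat.le_of_dvd T.den_pos (by exact_mod_cast hdvd)
  have hdb : d ≤ b₁ := by
    rw [hb₁, sq] at h
    exact Nat.le_of_mul_le_mul_right h hd
  rw [hv₁]
  nlinarith

theorem den_one_div_natCast_dvd (n : ℕ) : ((1 : ℚ) / n).den ∣ n := by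
  rcases Nat.eq_zero_or_pos n with rfl | h
  · simp
  · rw [one_div, Rat.inv_natCast_den_of_pos h]

theorem den_sum_one_div_dvd_lcm (A : Finset ℕ) : (∑ i ∈ A, (1 : ℚ) / i).den ∣ A.lcm id :=
  (Finset.Rat.den_sum_dvd_lcm_den _ _).trans
    (Finset.lcm_mono_fun fun i _ => den_one_div_natCast_dvd i)

theorem den_sum_one_div_dvd_prod (A : Finset ℕ) : (∑ i ∈ A, (1 : ℚ) / i).den ∣ ∏ i ∈ A, i :=
  (den_sum_one_div_dvd_lcm A).trans (Finset.lcm_dvd fun _ hi => Finset.dvd_prod_of_mem id hi)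

theorem Nat.Prime.exists_pow_dvd_of_pow_dvd_lcm {p k : ℕ} (hp : p.Prime) (hk : k ≠ 0)
    {A : Finset ℕ} (hA : ∀ x ∈ A, x ≠ 0) (h : p ^ k ∣ A.lcm id) : ∃ x ∈ A, p ^ k ∣ x := by
  have h0 : A.lcm id ≠ 0 := by
    rw [Ne, Finset.lcm_eq_zero_iff]
    rintro ⟨x, hx, hx0⟩
    exact hA x hx hx0
  rw [hp.pow_dvd_iff_le_factorization h0, Finset.factorization_lcm (f := id) hA] at h
  obtain ⟨x, hx, hkx⟩ := (Finset.le_sup_iff (Nat.pos_of_ne_zero hk)).1 h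
  exact ⟨x, hx, (hp.pow_dvd_iff_le_factorization (hA x hx)).2 hkx⟩

theorem Nat.gcd_finset_prod_dvd {ι : Type*} (s : Finset ι) (f : ι → ℕ) (b : ℕ) :
    b.gcd (∏ i ∈ s, f i) ∣ ∏ i ∈ s, b.gcd (f i) := by
  classical
  induction s using Finset.induction_on with
  | empty => simp
  | insert x s hx ih =>
    rw [Finset.prod_insert hx, Finset.prod_insert hx]
    exact (Nat.gcd_mul_right_dvd_mul_gcd _ _ _).trans (Nat.mul_dvd_mul_left _ ih)

/-! ### Cancellation and gcd bounds inside a block -/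

/-- The distance from the end of the block of the term attached to the prime `p`. -/
def blockOffset (τ p : ℕ) : ℕ := if p = 3 then 3 * τ else p

/-- The end point `b` of a block attached to a set `Q` of odd primes: the terms at `b` and
`b - blockOffset τ p` cancel modulo `p`, for each `p ∈ Q`. -/
structure IsBlockEnd (Q : Finset ℕ) (τ b : ℕ) : Prop where
  prime : ∀ p ∈ Q, p.Prime
  odd : ∀ p ∈ Q, p ≠ 2
  tau : τ = 1 ∨ τ = 2
  modEq : ∀ p ∈ Q, 2 * b ≡ blockOffset τ p [MOD p ^ 2]
  lt : ∀ p ∈ Q, blockOffset τ p < b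

theorem dvd_blockOffset (τ p : ℕ) : p ∣ blockOffset τ p := by
  unfold blockOffset
  split_ifs with h
  · exact h ▸ Dvd.intro _ rfl
  · exact dvd_rfl

theorem dvd_blockOffset_iff {τ p q : ℕ} (hτ : τ = 1 ∨ τ = 2) (hp : p.Prime) (hp2 : p ≠ 2)
    (hq : q.Prime) : p ∣ blockOffset τ q ↔ p = q := by
  refine ⟨fun h => ?_, fun h => h ▸ dvd_blockOffset τ p⟩
  unfold blockOffset at h
  split_ifs at h with h3
  · rcases (Nat.Prime.dvd_mul hp).1 h with h | h
    · rw [h3]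
      exact (Nat.prime_dvd_prime_iff_eq hp Nat.prime_three).1 h
    · rcases hτ with rfl | rfl
      · exact absurd (Nat.dvd_one.1 h) hp.one_lt.ne'
      · exact absurd ((Nat.prime_dvd_prime_iff_eq hp Nat.prime_two).1 h) hp2
  · exact (Nat.prime_dvd_prime_iff_eq hp hq).1 h

theorem not_sq_dvd_blockOffset {τ p : ℕ} (hτ : τ = 1 ∨ τ = 2) (hp : p.Prime) :
    ¬ p ^ 2 ∣ blockOffset τ p := by
  unfold blockOffset
  split_ifs with h3
  · subst h3
    rcases hτ with rfl | rfl <;> norm_num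
  · intro h
    have := Nat.le_of_dvd hp.pos h
    nlinarith [hp.two_le]

theorem le_blockOffset {τ : ℕ} (hτ : τ = 1 ∨ τ = 2) (p : ℕ) : p ≤ blockOffset τ p := by
  unfold blockOffset
  split_ifs <;> omega

theorem prod_blockOffset_le {τ : ℕ} (hτ : τ = 1 ∨ τ = 2) (Q : Finset ℕ) :
    ∏ p ∈ Q, blockOffset τ p ≤ 2 * ∏ p ∈ Q, p := by
  have : ∀ p, blockOffset τ p = (if p = 3 then τ else 1) * p := by
    intro p
    unfold blockOffset
    split_ifs with h
    · rw [h, mul_comm]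
    · rw [one_mul]
  simp_rw [this]
  rw [Finset.prod_mul_distrib, Finset.prod_ite_eq']
  refine Nat.mul_le_mul_right _ ?_
  split_ifs <;> omega

namespace IsBlockEnd

variable {Q : Finset ℕ} {τ b : ℕ}

theorem dvd_end (h : IsBlockEnd Q τ b) {p : ℕ} (hp : p ∈ Q) : p ∣ b := by
  have h1 : 2 * b ≡ blockOffset τ p [MOD p] := (h.modEq p hp).of_dvd (dvd_pow_self p two_ne_zero)
  have h2 : p ∣ 2 * b := (h1.dvd_iff dvd_rfl).2 (dvd_blockOffset τ p)
  refine ((h.prime p hp).dvd_mul.1 h2).resolve_left fun h3 => h.odd p hp ?_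
  exact (Nat.prime_dvd_prime_iff_eq (h.prime p hp) Nat.prime_two).1 h3

theorem not_sq_dvd_end (h : IsBlockEnd Q τ b) {p : ℕ} (hp : p ∈ Q) : ¬ p ^ 2 ∣ b := fun h1 =>
  not_sq_dvd_blockOffset h.tau (h.prime p hp)
    (((h.modEq p hp).dvd_iff dvd_rfl).1 (h1.mul_left 2))

/-- Every p in Q divides b, and the only odd prime factor of the offset of q is q. -/
theorem dvd_sub_iff (h : IsBlockEnd Q τ b) {p q : ℕ} (hp : p ∈ Q) (hq : q ∈ Q) :
    p ∣ b - blockOffset τ q ↔ p = q := by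
  rw [← dvd_blockOffset_iff h.tau (h.prime p hp) (h.odd p hp) (h.prime q hq)]
  exact Nat.dvd_sub_iff_right (h.lt q hq).le (h.dvd_end hp)

theorem not_sq_dvd_sub (h : IsBlockEnd Q τ b) {p : ℕ} (hp : p ∈ Q) :
    ¬ p ^ 2 ∣ b - blockOffset τ p := by
  intro h1
  have hlt := h.lt p hp
  have h2 : p ^ 2 ∣ 2 * b - blockOffset τ p :=
    (Nat.modEq_iff_dvd' (by omega)).1 (h.modEq p hp).symm
  have h3 : 2 * b - blockOffset τ p = (b - blockOffset τ p) + b := by omega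
  rw [h3, Nat.dvd_add_right h1] at h2
  exact h.not_sq_dvd_end hp h2

theorem blockOffset_injOn (h : IsBlockEnd Q τ b) : Set.InjOn (blockOffset τ) Q := by
  intro p hp q hq hpq
  rw [← dvd_blockOffset_iff h.tau (h.prime p hp) (h.odd p hp) (h.prime q hq), ← hpq]
  exact dvd_blockOffset τ p

theorem not_dvd_den_sum_erase (h : IsBlockEnd Q τ b) {p : ℕ} (hp : p ∈ Q) :
    ¬ p ∣ (∑ q ∈ Q.erase p, (1 : ℚ) / ((b - blockOffset τ q : ℕ) : ℚ)).den := by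
  intro h1
  have h2 := (h1.trans (Finset.Rat.den_sum_dvd_prod_den _ _)).trans
    (Finset.prod_dvd_prod_of_dvd _ _ fun q _ => den_one_div_natCast_dvd (b - blockOffset τ q))
  obtain ⟨q, hq, hpq⟩ := ((h.prime p hp).prime.dvd_finsetProd_iff _).1 h2
  have := (h.dvd_sub_iff hp (Finset.mem_of_mem_erase hq)).1 hpq
  exact Finset.ne_of_mem_erase hq this.symm

theorem dvd_den_sum (h : IsBlockEnd Q τ b) {p : ℕ} (hp : p ∈ Q) :
    p ∣ (∑ q ∈ Q, (1 : ℚ) / ((b - blockOffset τ q : ℕ) : ℚ)).den := by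
  by_contra hcon
  have h1 := Rat.sub_den_dvd (∑ q ∈ Q, (1 : ℚ) / ((b - blockOffset τ q : ℕ) : ℚ))
    (∑ q ∈ Q.erase p, (1 : ℚ) / ((b - blockOffset τ q : ℕ) : ℚ))
  rw [← Finset.add_sum_erase Q _ hp, add_sub_cancel_right, Finset.add_sum_erase Q
    (fun q => (1 : ℚ) / ((b - blockOffset τ q : ℕ) : ℚ)) hp, one_div,
    Rat.inv_natCast_den_of_pos (by have := h.lt p hp; omega)] at h1
  rcases (h.prime p hp).dvd_mul.1 (((h.dvd_sub_iff hp hp).2 rfl).trans h1) with h2 | h2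
  · exact hcon h2
  · exact h.not_dvd_den_sum_erase hp h2

theorem not_dvd_den_sum_add (h : IsBlockEnd Q τ b) {p : ℕ} (hp : p ∈ Q) :
    ¬ p ∣ (∑ q ∈ Q, (1 : ℚ) / ((b - blockOffset τ q : ℕ) : ℚ) + 1 / (b : ℚ)).den := by
  intro hcon
  have hlt := h.lt p hp
  have hpp := h.prime p hp
  obtain ⟨m, hm⟩ := h.dvd_end hp
  obtain ⟨l, hl⟩ := (h.dvd_sub_iff hp hp).2 rfl
  obtain ⟨s, hs⟩ : p ^ 2 ∣ 2 * b - blockOffset τ p :=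
    (Nat.modEq_iff_dvd' (by omega)).1 (h.modEq p hp).symm
  have hm' : ¬ p ∣ m := fun ⟨x, hx⟩ => h.not_sq_dvd_end hp ⟨x, by rw [hm, hx]; ring⟩
  have hl' : ¬ p ∣ l := fun ⟨x, hx⟩ => h.not_sq_dvd_sub hp ⟨x, by rw [hl, hx]; ring⟩
  have hm0 : (m : ℚ) ≠ 0 := by
    rintro h0
    exact hm' (by rw [Nat.cast_eq_zero.1 h0]; exact dvd_zero p)
  have hl0 : (l : ℚ) ≠ 0 := by
    rintro h0
    exact hl' (by rw [Nat.cast_eq_zero.1 h0]; exact dvd_zero p)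
  have hp0 : (p : ℚ) ≠ 0 := by exact_mod_cast hpp.ne_zero
  have hsum : m + l = p * s := by
    have : p * (m + l) = p * (p * s) := by
      rw [mul_add, ← hm, ← hl, ← mul_assoc, ← sq, ← hs]
      omega
    exact Nat.eq_of_mul_eq_mul_left hpp.pos this
  -- The two multiples of p add up to p²s, so 1/(pl) + 1/(pm) = s/(lm) with l and m prime to p.
  have hpair : (1 : ℚ) / ((b - blockOffset τ p : ℕ) : ℚ) + 1 / (b : ℚ)
      = Rat.divInt s (m * l) := by
    rw [Rat.divInt_eq_div, hl, hm]
    have : (m : ℚ) + l = p * s := by exact_mod_cast hsum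
    push_cast
    field_simp
    linarith
  rw [← Finset.add_sum_erase Q _ hp, add_right_comm, hpair] at hcon
  rcases hpp.dvd_mul.1 (hcon.trans (Rat.add_den_dvd _ _)) with h2 | h2
  · have h3 : p ∣ m * l := h2.trans (by exact_mod_cast Rat.den_dvd s (m * l))
    exact (hpp.dvd_mul.1 h3).elim hm' hl'
  · exact h.not_dvd_den_sum_erase hp h2

theorem prod_coprime {n : ℕ} (h : IsBlockEnd Q τ b) (hn : ∀ p ∈ Q, ¬ p ∣ n) :
    Nat.Coprime n (∏ p ∈ Q, p) :=
  Nat.Coprime.prod_right fun p hp => (((h.prime p hp).coprime_iff_not_dvd).2 (hn p hp)).symm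

theorem prod_dvd {n : ℕ} (h : IsBlockEnd Q τ b) (hn : ∀ p ∈ Q, p ∣ n) : ∏ p ∈ Q, p ∣ n :=
  Finset.prod_primes_dvd n (fun p hp => (h.prime p hp).prime) hn

/-- The denominator drops at the end of the block. -/
theorem den_lt (h : IsBlockEnd Q τ b) (hb : 0 < b) (hlt : b < (∏ p ∈ Q, p) ^ 2) :
    (∑ q ∈ Q, (1 : ℚ) / ((b - blockOffset τ q : ℕ) : ℚ) + 1 / (b : ℚ)).den
      < (∑ q ∈ Q, (1 : ℚ) / ((b - blockOffset τ q : ℕ) : ℚ)).den := by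
  set S := ∑ q ∈ Q, (1 : ℚ) / ((b - blockOffset τ q : ℕ) : ℚ) with hS
  have hcop := h.prod_coprime fun p hp => h.not_dvd_den_sum_add hp
  obtain ⟨s, hs⟩ := h.prod_dvd fun p hp => h.dvd_den_sum hp
  obtain ⟨m, hm⟩ := h.prod_dvd fun p hp => h.dvd_end hp
  rw [← hS] at hs hcop
  set P := ∏ p ∈ Q, p with hP
  have hdvd : (S + 1 / (b : ℚ)).den ∣ P * (s * m) := by
    refine (Rat.add_den_dvd_lcm _ _).trans (Nat.lcm_dvd ?_ ?_)
    · exact ⟨m, by rw [hs]; ring⟩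
    · exact (den_one_div_natCast_dvd b).trans ⟨s, by rw [hm]; ring⟩
  have hsm := hcop.dvd_of_dvd_mul_left hdvd
  have hs0 : 0 < s := Nat.pos_of_mul_pos_left (hs ▸ S.den_pos)
  have hm0 : 0 < m := Nat.pos_of_mul_pos_left (hm ▸ hb)
  have hle := Nat.le_of_dvd (Nat.mul_pos hs0 hm0) hsm
  have hmP : m < P := by
    rw [hm, sq] at hlt
    exact Nat.lt_of_mul_lt_mul_left hlt
  rw [hs]
  nlinarith

/-- A common divisor of b and b - x divides x, so the gcd divides the product of the offsets over R;
the factor 2 allows for the offset 6 of the prime 3. -/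
theorem gcd_den_le (h : IsBlockEnd Q τ b) {R A : Finset ℕ} (hR : R ⊆ Q)
    (hA : A ⊆ R.image fun q => b - blockOffset τ q) :
    b.gcd (∑ i ∈ A, (1 : ℚ) / i).den ≤ 2 * ∏ p ∈ R, p := by
  have h1 : (∑ i ∈ A, (1 : ℚ) / i).den ∣ ∏ q ∈ R, (b - blockOffset τ q) := by
    refine (den_sum_one_div_dvd_lcm A).trans (Finset.lcm_dvd fun x hx => ?_)
    obtain ⟨q, hq, rfl⟩ := Finset.mem_image.1 (hA hx)
    exact Finset.dvd_prod_of_mem (fun q => b - blockOffset τ q) hq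
  have h2 : b.gcd (∑ i ∈ A, (1 : ℚ) / i).den ∣ ∏ q ∈ R, blockOffset τ q := by
    refine ((Nat.gcd_dvd_gcd_of_dvd_right _ h1).trans (Nat.gcd_finset_prod_dvd _ _ _)).trans
      (Finset.prod_dvd_prod_of_dvd _ _ fun q hq => ?_)
    exact (Nat.dvd_sub_iff_right (h.lt q (hR hq)).le (Nat.gcd_dvd_left _ _)).1
      (Nat.gcd_dvd_right _ _)
  refine (Nat.le_of_dvd (Finset.prod_pos fun q hq => ?_) h2).trans (prod_blockOffset_le h.tau R)
  exact (h.prime q (hR hq)).pos.trans_le (le_blockOffset h.tau q)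

/-- A prime power dividing the gcd divides an earlier term, hence a difference of two terms, which
is at most K. No prime of Q divides the gcd, since before b it divides only its own term. -/
theorem gcd_den_mul_prod_le (h : IsBlockEnd Q τ b) {K : ℕ} (hK : ∀ q ∈ Q, blockOffset τ q ≤ K)
    {p : ℕ} (hp : p ∈ Q) {A : Finset ℕ} (hA : A ⊆ Q.image fun q => b - blockOffset τ q)
    (hlt : ∀ x ∈ A, x < b - blockOffset τ p) :
    (b - blockOffset τ p).gcd (∑ i ∈ A, (1 : ℚ) / i).den * ∏ q ∈ Q, q ≤ Nat.lcmUpto K := by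
  refine Nat.le_of_dvd (Nat.lcmUpto_pos K) (Nat.Coprime.mul_dvd_of_dvd_of_dvd ?_ ?_ ?_)
  · refine h.prod_coprime fun q hq hdvd => ?_
    have h1 := (h.dvd_sub_iff hq hp).1 (hdvd.trans (Nat.gcd_dvd_left _ _))
    subst h1
    have h2 := (hdvd.trans (Nat.gcd_dvd_right _ _)).trans (den_sum_one_div_dvd_prod A)
    obtain ⟨x, hx, hqx⟩ := ((h.prime q hq).prime.dvd_finsetProd_iff _).1 h2
    obtain ⟨q', hq', rfl⟩ := Finset.mem_image.1 (hA hx)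
    have := (h.dvd_sub_iff hq hq').1 hqx
    subst this
    exact (hlt _ hx).false
  · rw [Nat.dvd_iff_prime_pow_dvd_dvd]
    intro l k hl hlk
    rcases Nat.eq_zero_or_pos k with rfl | hk
    · simp
    obtain ⟨x, hx, hlx⟩ := hl.exists_pow_dvd_of_pow_dvd_lcm hk.ne' (fun x hx => by
      obtain ⟨q', hq', rfl⟩ := Finset.mem_image.1 (hA hx)
      have := h.lt q' hq'
      omega) ((hlk.trans (Nat.gcd_dvd_right _ _)).trans (den_sum_one_div_dvd_lcm A))
    have hsub := Nat.dvd_sub (hlk.trans (Nat.gcd_dvd_left _ _)) hlx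
    refine hsub.trans (Finset.dvd_lcm (f := id) (Finset.mem_Icc.2 ?_))
    have hxlt := hlt x hx
    obtain ⟨q', hq', rfl⟩ := Finset.mem_image.1 (hA hx)
    have := hK q' hq'
    omega
  · refine h.prod_dvd fun q hq => Finset.dvd_lcm (f := id) (Finset.mem_Icc.2 ?_)
    exact ⟨(h.prime q hq).one_le, (le_blockOffset h.tau q).trans (hK q hq)⟩

end IsBlockEnd

/-! ### Existence of blocks -/

theorem exists_modEq_blockOffset {Q : Finset ℕ} (hQ : ∀ p ∈ Q, p.Prime) (hQ2 : ∀ p ∈ Q, p ≠ 2)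
    (τ : ℕ) : ∃ b < (∏ p ∈ Q, p) ^ 2, ∀ p ∈ Q, 2 * b ≡ blockOffset τ p [MOD p ^ 2] := by
  have hs : ∀ p ∈ Q, p ^ 2 ≠ 0 := fun p hp => pow_ne_zero 2 (hQ p hp).ne_zero
  have hpp : Set.Pairwise (Q : Set ℕ) (Function.onFun Nat.Coprime fun p => p ^ 2) :=
    fun p hp q hq hpq => Nat.Coprime.pow 2 2 ((Nat.coprime_primes (hQ p hp) (hQ q hq)).2 hpq)
  -- (p² + 1)/2 is the inverse of 2 modulo p².
  refine ⟨Nat.chineseRemainderOfFinset (fun p => blockOffset τ p * ((p ^ 2 + 1) / 2))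
    (fun p => p ^ 2) Q hs hpp, ?_, fun p hp => ?_⟩
  · rw [← Finset.prod_pow]
    exact Nat.chineseRemainderOfFinset_lt_prod _ _ hs hpp
  · have h1 := (Nat.chineseRemainderOfFinset (fun p => blockOffset τ p * ((p ^ 2 + 1) / 2))
      (fun p => p ^ 2) Q hs hpp).2 p hp
    refine (h1.mul_left 2).trans ?_
    have hodd : Odd (p ^ 2) := ((hQ p hp).odd_of_ne_two (hQ2 p hp)).pow
    have h2 : 2 * ((p ^ 2 + 1) / 2) = p ^ 2 + 1 := by
      obtain ⟨k, hk⟩ := hodd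
      omega
    have h3 : 2 * (blockOffset τ p * ((p ^ 2 + 1) / 2))
        = blockOffset τ p + p ^ 2 * blockOffset τ p := by
      rw [mul_left_comm, h2]; ring
    rw [h3]
    simp [Nat.ModEq]

/-- A single residue mod P² could be tiny. The solutions for τ = 1 and τ = 2 are distinct but agree
modulo P²/9, so the larger is at least P²/9. -/
theorem exists_large_modEq_blockOffset {Q : Finset ℕ} (hQ : ∀ p ∈ Q, p.Prime)
    (hQ2 : ∀ p ∈ Q, p ≠ 2) (h3 : 3 ∈ Q) : ∃ τ b, (τ = 1 ∨ τ = 2) ∧ b < (∏ p ∈ Q, p) ^ 2 ∧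
      (∏ p ∈ Q, p) ^ 2 ≤ 9 * b ∧ ∀ p ∈ Q, 2 * b ≡ blockOffset τ p [MOD p ^ 2] := by
  obtain ⟨b₁, hb₁, hm₁⟩ := exists_modEq_blockOffset hQ hQ2 1
  obtain ⟨b₂, hb₂, hm₂⟩ := exists_modEq_blockOffset hQ hQ2 2
  have hP : (∏ p ∈ Q, p) ^ 2 = 9 * ∏ p ∈ Q.erase 3, p ^ 2 := by
    rw [← Finset.mul_prod_erase Q _ h3, mul_pow, Finset.prod_pow]
    norm_num
  have hmod : ∀ p ∈ Q.erase 3, b₁ ≡ b₂ [MOD p ^ 2] := by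
    intro p hp
    obtain ⟨hp3, hpQ⟩ := Finset.mem_erase.1 hp
    have h1 := (hm₁ p hpQ).trans (by
      simpa [blockOffset, hp3] using (hm₂ p hpQ).symm)
    refine Nat.ModEq.cancel_left_of_coprime ?_ h1
    exact Nat.Coprime.pow_left 2 ((Nat.coprime_primes (hQ p hpQ) Nat.prime_two).2 (hQ2 p hpQ))
  have hmodP : b₁ ≡ b₂ [MOD ∏ p ∈ Q.erase 3, p ^ 2] := by
    rw [Nat.modEq_iff_dvd]
    push_cast
    refine Finset.prod_dvd_of_coprime (fun p hp q hq hpq => ?_) fun p hp => ?_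
    · have := (Nat.coprime_primes (hQ p (Finset.mem_of_mem_erase hp))
        (hQ q (Finset.mem_of_mem_erase hq))).2 hpq
      exact (Nat.isCoprime_iff_coprime.2 this).pow
    · exact_mod_cast (Nat.modEq_iff_dvd.1 (hmod p hp))
  have hne : b₁ ≠ b₂ := by
    rintro rfl
    have h1 := (hm₁ 3 h3).symm.trans (hm₂ 3 h3)
    revert h1
    decide
  rcases lt_or_gt_of_ne hne with hlt | hlt
  · refine ⟨2, b₂, Or.inr rfl, hb₂, ?_, hm₂⟩
    have := Nat.le_of_dvd (by omega) ((Nat.modEq_iff_dvd' hlt.le).1 hmodP)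
    omega
  · refine ⟨1, b₁, Or.inl rfl, hb₁, ?_, hm₁⟩
    have := Nat.le_of_dvd (by omega) ((Nat.modEq_iff_dvd' hlt.le).1 hmodP.symm)
    omega

-- Holds because 2 log 4 < 3. With 3K ≤ 4 log P it yields 18 lcm(1, ..., K)² ≤ P⁴.
open Chebyshev in
theorem exists_forall_psi_le : ∃ N : ℕ, ∀ K : ℕ, N ≤ K →
    Real.log 18 + 2 * ψ (K : ℝ) ≤ 3 * K := by
  obtain ⟨A, hA⟩ := psi_sub_theta_le_mul_sqrt
  obtain ⟨N, hN⟩ := exists_nat_ge ((Real.log 18 + 20 * A ^ 2) / (1 / 10))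
  refine ⟨N, fun K hK => ?_⟩
  have h1 := hA K
  have h2 := theta_le_log4_mul_x (x := (K : ℝ)) (by positivity)
  have h3 : A * √(K : ℝ) ≤ 1 / 20 * K + 10 * A ^ 2 := by
    have hs : √(K : ℝ) ^ 2 = K := Real.sq_sqrt (by positivity)
    nlinarith [sq_nonneg (√(K : ℝ) - 10 * A)]
  have h4 : Real.log 4 ≤ 1.39 := by
    have : Real.log 4 = 2 * Real.log 2 := by
      rw [show (4 : ℝ) = 2 ^ 2 by norm_num, Real.log_pow]; norm_num
    linarith [Real.log_two_lt_d9]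
  have h5 : (N : ℝ) ≤ K := by exact_mod_cast hK
  have h6 := mul_le_mul_of_nonneg_right h4 (Nat.cast_nonneg (α := ℝ) K)
  rw [div_le_iff₀ (by norm_num)] at hN
  linarith

/-- There are blocks beyond any given bound in which the denominator drops at the last term `b`,
starting from `b - K`, where `K` is about `log b / 2`, and in which every drop takes at least `K`
steps. -/
theorem exists_block {ε : ℝ} (hε : 0 < ε) (hε1 : ε ≤ 1) (M : ℕ) :
    ∃ (b K : ℕ) (B : Finset ℕ), 2 * M + 1 ≤ b - K ∧ 1 ≤ K ∧ b ∈ B ∧ B ⊆ Finset.Icc (b - K) b ∧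
      Real.log b ≤ 2 * K ∧ (K : ℝ) ≤ (1 / 2 + ε) * Real.log ((b - K : ℕ) : ℝ) ∧
      (∑ i ∈ B, (1 : ℚ) / i).den < (∑ i ∈ B.erase b, (1 : ℚ) / i).den ∧
      ∀ a, ∀ c ∈ B, c < a + K →
        (∑ i ∈ B with a ≤ i ∧ i < c, (1 : ℚ) / i).den
          ≤ (∑ i ∈ B with a ≤ i ∧ i < c, (1 : ℚ) / i + 1 / (c : ℚ)).den := by
  obtain ⟨N₁, hN₁⟩ := exists_forall_psi_le
  obtain ⟨N₂, hN₂⟩ := exists_nat_ge (Real.log 18 / (2 * (ε / 4)))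
  obtain ⟨K, hK, hKp, Q, hQ, h3, hKQ, hlow, hupp⟩ := exists_prime_finset (δ := ε / 4)
    (by linarith) (by linarith) (N₁ + N₂ + 2 * M + 18)
  have hQp : ∀ p ∈ Q, p.Prime := fun p hp => (hQ p hp).1
  have hQ2 : ∀ p ∈ Q, p ≠ 2 := fun p hp => (hQ p hp).2.1
  obtain ⟨τ, b, hτ, hlt, hge, hmod⟩ := exists_large_modEq_blockOffset hQp hQ2 h3
  set P := ∏ p ∈ Q, p with hP
  have hPpos : 0 < P := Finset.prod_pos fun p hp => (hQp p hp).pos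
  have hlogP : Real.log P = ∑ p ∈ Q, Real.log p := by
    rw [hP, Nat.cast_prod, Real.log_prod]
    exact fun p hp => by exact_mod_cast (hQp p hp).ne_zero
  rw [← hlogP] at hlow hupp
  have hK0 : (0 : ℝ) < K := by exact_mod_cast hKp.pos
  set R := ∏ p ∈ Q.erase K, p with hR
  have hPR : P = K * R := (Finset.mul_prod_erase Q _ hKQ).symm
  have hRpos : 0 < R := Finset.prod_pos fun p hp => (hQp p (Finset.mem_of_mem_erase hp)).pos
  have hKP : 18 * K ≤ P ^ 2 := by
    have : K ≤ P := hPR ▸ Nat.le_mul_of_pos_right K hRpos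
    nlinarith
  have hbK : 2 * K ≤ b := by omega
  have hoff : ∀ q ∈ Q, blockOffset τ q ≤ K := by
    intro q hq
    unfold blockOffset
    split_ifs
    · omega
    · exact (hQ q hq).2.2
  have hblock : IsBlockEnd Q τ b :=
    ⟨hQp, hQ2, hτ, hmod, fun p hp => (hoff p hp).trans_lt (by omega)⟩
  set g : ℕ → ℕ := fun q => b - blockOffset τ q with hg
  have hbg : b ∉ Q.image g := by
    intro hb
    obtain ⟨q, hq, hqb⟩ := Finset.mem_image.1 hb
    have h1 := (hQp q hq).pos.trans_le (le_blockOffset hτ q)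
    have h2 := hblock.lt q hq
    simp only [hg] at hqb
    omega
  have hsum : ∑ i ∈ Q.image g, (1 : ℚ) / i = ∑ q ∈ Q, (1 : ℚ) / ((b - blockOffset τ q : ℕ) : ℚ) := by
    refine Finset.sum_image fun p hp q hq hpq => hblock.blockOffset_injOn hp hq ?_
    have h1 := hblock.lt p hp
    have h2 := hblock.lt q hq
    simp only [hg] at hpq
    omega
  have hPsq : (P : ℝ) ^ 2 ≤ 18 * ((b - K : ℕ) : ℝ) := by
    have : P ^ 2 ≤ 18 * (b - K) := by omega
    exact_mod_cast this
  have hPR0 : (0 : ℝ) < P := by exact_mod_cast hPpos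
  refine ⟨b, K, insert b (Q.image g), by omega, hKp.one_le, by simp, ?_, ?_, ?_, ?_, ?_⟩
  · intro x hx
    rcases Finset.mem_insert.1 hx with rfl | hx
    · simp
    · obtain ⟨q, hq, rfl⟩ := Finset.mem_image.1 hx
      have := hoff q hq
      simp only [hg, Finset.mem_Icc]
      omega
  · have h1 : Real.log b ≤ Real.log ((P : ℝ) ^ 2) :=
      Real.log_le_log (by exact_mod_cast (by omega : 0 < b)) (by exact_mod_cast hlt.le)
    rw [Real.log_pow] at h1
    push_cast at h1
    linarith
  · have hbK0 : (0 : ℝ) < ((b - K : ℕ) : ℝ) := by exact_mod_cast (by omega : 0 < b - K)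
    have h1 := Real.log_le_log (by positivity) hPsq
    rw [Real.log_pow, Real.log_mul (by norm_num) hbK0.ne'] at h1
    push_cast at h1
    have h2 : (N₂ : ℝ) ≤ K := by exact_mod_cast (by omega : N₂ ≤ K)
    have h3 : Real.log 18 ≤ K * (2 * (ε / 4)) := (div_le_iff₀ (by linarith)).1 (hN₂.trans h2)
    have h4 : (2 - ε) * K ≤ Real.log ((b - K : ℕ) : ℝ) := by nlinarith
    have h5 : (1 / 2 + ε) * ((2 - ε) * K) ≤ (1 / 2 + ε) * Real.log ((b - K : ℕ) : ℝ) :=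
      mul_le_mul_of_nonneg_left h4 (by linarith)
    have h6 : 0 ≤ (ε * (3 / 2 - ε)) * K := mul_nonneg (mul_nonneg hε.le (by linarith)) hK0.le
    nlinarith
  · rw [Finset.sum_insert hbg, Finset.erase_insert hbg, hsum, add_comm]
    exact hblock.den_lt (by omega) hlt
  · intro a c hc hca
    have hcpos : 0 < c := by
      rcases Finset.mem_insert.1 hc with rfl | hc
      · omega
      · obtain ⟨q, hq, rfl⟩ := Finset.mem_image.1 hc
        have := hblock.lt q hq
        simp only [hg]
        omega
    refine den_le_den_add_one_div _ hcpos ?_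
    rcases Finset.mem_insert.1 hc with rfl | hc
    -- Since a > b - K, the term attached to K is absent; this costs the gcd a factor K.
    · have hA : (insert c (Q.image g)).filter (fun i => a ≤ i ∧ i < c) ⊆ (Q.erase K).image g := by
        intro x hx
        obtain ⟨hx1, hx2, hx3⟩ := Finset.mem_filter.1 hx
        obtain ⟨q, hq, rfl⟩ := Finset.mem_image.1 (Finset.mem_of_mem_insert_of_ne hx1 hx3.ne)
        refine Finset.mem_image_of_mem g (Finset.mem_erase.2 ⟨?_, hq⟩)
        rintro rfl
        have := le_blockOffset hτ q
        simp only [hg] at hx2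
        omega
      have h1 := hblock.gcd_den_le (Finset.erase_subset K Q) hA
      refine (Nat.pow_le_pow_left h1 2).trans ?_
      rw [← hR]
      have h2 : (6 * R) ^ 2 ≤ P ^ 2 :=
        Nat.pow_le_pow_left (hPR ▸ Nat.mul_le_mul_right R (by omega)) 2
      nlinarith
    · obtain ⟨p, hp, rfl⟩ := Finset.mem_image.1 hc
      have hA : (insert b (Q.image g)).filter (fun i => a ≤ i ∧ i < g p) ⊆ Q.image g := by
        intro x hx
        obtain ⟨hx1, hx2, hx3⟩ := Finset.mem_filter.1 hx
        refine Finset.mem_of_mem_insert_of_ne hx1 ?_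
        simp only [hg] at hx3
        omega
      have h1 := hblock.gcd_den_mul_prod_le hoff hp hA fun x hx => (Finset.mem_filter.1 hx).2.2
      set d := (g p).gcd (∑ i ∈ insert b (Q.image g) with a ≤ i ∧ i < g p, (1 : ℚ) / i).den with hd
      have h2 : 18 * (Nat.lcmUpto K) ^ 2 ≤ P ^ 4 := by
        have hL : (0 : ℝ) < Nat.lcmUpto K := by exact_mod_cast Nat.lcmUpto_pos K
        have h3 := hN₁ K (by omega)
        rw [Chebyshev.psi_eq_log_lcmUpto] at h3
        have h4 : Real.log (18 * (Nat.lcmUpto K : ℝ) ^ 2) ≤ Real.log ((P : ℝ) ^ 4) := by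
          rw [Real.log_mul (by norm_num) (by positivity), Real.log_pow, Real.log_pow]
          push_cast
          nlinarith
        exact_mod_cast (Real.log_le_log_iff (by positivity) (by positivity)).1 h4
      -- Together with the previous bound, 18d² ≤ P² ≤ 18(b - K), so d² is at most the term `g p`.
      have h3 : (d * P) ^ 2 ≤ (Nat.lcmUpto K) ^ 2 := Nat.pow_le_pow_left h1 2
      have h4 : P ^ 2 * (18 * d ^ 2) ≤ P ^ 2 * P ^ 2 := by nlinarith
      have h5 := Nat.le_of_mul_le_mul_left h4 (by positivity)
      have h6 := hoff p hp
      simp only [hg]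
      omega

/-! ### From drops to bounds on the extended-real ratio -/

theorem firstDrop_eq (r : ℕ → ℤ) (a : ℕ) : firstDrop r a = ⊤ ∨
    ∃ b : ℕ, (a < b ∧ sumDenom r a b < sumDenom r a (b - 1)) ∧ firstDrop r a = b := by
  classical
  by_cases h : ∃ b : ℕ, a < b ∧ sumDenom r a b < sumDenom r a (b - 1)
  · refine Or.inr ⟨Nat.find h, Nat.find_spec h, le_antisymm ?_ ?_⟩
    all_goals unfold firstDrop
    · exact iInf₂_le (Nat.find h) (Nat.find_spec h)
    · exact le_iInf₂ fun b hb => by exact_mod_cast Nat.find_min' h hb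
  · refine Or.inl ?_
    push Not at h
    simp only [firstDrop, iInf_eq_top]
    exact fun b hb => absurd hb.2 (not_lt.2 (h b hb.1))

theorem EReal.coe_toENNReal_natCast (b : ℕ) :
    (((b : ℕ∞) : ENNReal) : EReal) = ((b : ℝ) : EReal) := by
  rw [ENat.toENNReal_coe]
  rfl

theorem half_le_dropRatio {r : ℕ → ℤ} {a : ℕ} (ha : 2 ≤ a)
    (h : ∀ b, a < b → sumDenom r a b < sumDenom r a (b - 1) → Real.log a ≤ 2 * ((b : ℝ) - a)) :
    ((1 / 2 : ℝ) : EReal) ≤ dropRatio r a := by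
  have hlog : 0 < Real.log a := Real.log_pos (by exact_mod_cast ha)
  rw [dropRatio, EReal.le_div_iff_mul_le (by exact_mod_cast hlog) (EReal.coe_ne_top _)]
  rcases firstDrop_eq r a with h1 | ⟨b, ⟨hb1, hb2⟩, h1⟩
  · rw [h1]
    have : ((⊤ : ENNReal) : EReal) - (a : EReal) = ⊤ := by
      rw [EReal.coe_ennreal_top]
      exact EReal.top_sub_coe (a : ℝ)
    rw [ENat.toENNReal_top, this]
    exact le_top
  · rw [h1]
    have h2 := h b hb1 hb2
    have h3 : (1 / 2 : ℝ) * Real.log a ≤ (b : ℝ) - a := by linarith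
    rw [EReal.coe_toENNReal_natCast]
    exact_mod_cast h3

theorem dropRatio_le {r : ℕ → ℤ} {a b : ℕ} {c : ℝ} (ha : 2 ≤ a) (hab : a < b)
    (h : sumDenom r a b < sumDenom r a (b - 1)) (hc : (b : ℝ) - a ≤ c * Real.log a) :
    dropRatio r a ≤ (c : EReal) := by
  have hlog : 0 < Real.log a := Real.log_pos (by exact_mod_cast ha)
  rw [dropRatio, EReal.div_le_iff_le_mul (by exact_mod_cast hlog) (EReal.coe_ne_top _)]
  have h1 : firstDrop r a ≤ b := iInf₂_le b ⟨hab, h⟩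
  have h2 : ((firstDrop r a : ENNReal) : EReal) ≤ ((b : ℝ) : EReal) := by
    have h3 : (firstDrop r a : ENNReal) ≤ ((b : ℕ∞) : ENNReal) := by exact_mod_cast h1
    rw [← EReal.coe_toENNReal_natCast]
    exact_mod_cast h3
  refine (EReal.sub_le_sub h2 le_rfl).trans ?_
  rw [mul_comm]
  exact_mod_cast hc

theorem sumDenom_pred {r : ℕ → ℤ} {a c : ℕ} (h : r c = 0) :
    sumDenom r a (c - 1) = sumDenom r a c := by
  rcases Nat.eq_zero_or_pos c with rfl | hc
  · rfl
  rcases le_or_gt a c with hac | hac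
  · obtain ⟨d, rfl⟩ := Nat.exists_eq_add_of_lt hc
    simp only [zero_add, Nat.add_sub_cancel] at *
    rw [sumDenom, sumDenom, Finset.sum_Icc_succ_top hac]
    simp [h]
  · rw [sumDenom, sumDenom, Finset.Icc_eq_empty (by omega), Finset.Icc_eq_empty (by omega)]

/-! ### Gluing the blocks -/

theorem exists_block_sequence : ∃ (m K : ℕ → ℕ) (B : ℕ → Finset ℕ), ∀ n,
    2 * m n + 1 ≤ m (n + 1) - K n ∧ 1 ≤ K n ∧ m (n + 1) ∈ B n ∧
      B n ⊆ Finset.Icc (m (n + 1) - K n) (m (n + 1)) ∧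
      Real.log (m (n + 1)) ≤ 2 * K n ∧
      (K n : ℝ) ≤ (1 / 2 + 1 / ((n : ℝ) + 1)) * Real.log ((m (n + 1) - K n : ℕ) : ℝ) ∧
      (∑ i ∈ B n, (1 : ℚ) / i).den < (∑ i ∈ (B n).erase (m (n + 1)), (1 : ℚ) / i).den ∧
      ∀ a, ∀ c ∈ B n, c < a + K n →
        (∑ i ∈ B n with a ≤ i ∧ i < c, (1 : ℚ) / i).den
          ≤ (∑ i ∈ B n with a ≤ i ∧ i < c, (1 : ℚ) / i + 1 / (c : ℚ)).den := by
  choose b K B h using fun (n M : ℕ) =>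
    exists_block (ε := 1 / ((n : ℝ) + 1)) (by positivity)
      (by rw [div_le_one (by positivity)]; linarith [Nat.cast_nonneg (α := ℝ) n]) M
  let m : ℕ → ℕ := fun n => Nat.rec 0 (fun n x => b n x) n
  exact ⟨m, fun n => K n (m n), fun n => B n (m n), fun n => h n (m n)⟩

theorem mainTheorem12 :
    ∃ r : ℕ → ℤ,
      (∀ i : ℕ, 1 ≤ i → r i = 0 ∨ r i = 1) ∧
      ¬ IsPeriodicSeq r ∧
      Filter.liminf (fun a : ℕ => dropRatio r a) Filter.atTop = (((1 / 2 : ℝ)) : EReal) := by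
  classical
  obtain ⟨m, K, B, h⟩ := exists_block_sequence
  have hstep : ∀ n, 2 * m n + 1 ≤ m (n + 1) - K n := fun n => (h n).1
  have hmono : StrictMono m := strictMono_nat_of_lt_succ fun n => by
    have := hstep n
    omega
  have hlow : ∀ n, ∀ i ∈ B n, m (n + 1) - K n ≤ i ∧ i ≤ m (n + 1) := fun n i hi =>
    Finset.mem_Icc.1 ((h n).2.2.2.1 hi)
  have huniq : ∀ n k i, m n < i → i ≤ m (n + 1) → i ∈ B k → k = n := by
    intro n k i h1 h2 h3
    have h4 := hlow k i h3
    have h5 := hstep k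
    rcases lt_trichotomy k n with hk | hk | hk
    · have := hmono.monotone (Nat.succ_le_of_lt hk)
      simp only [Nat.succ_eq_add_one] at this
      omega
    · exact hk
    · have := hmono.monotone (Nat.succ_le_of_lt hk)
      simp only [Nat.succ_eq_add_one] at this
      omega
  let r : ℕ → ℤ := fun i => if ∃ n, i ∈ B n then 1 else 0
  have hr1 : ∀ n, ∀ i ∈ B n, r i = 1 := fun n i hi => if_pos ⟨n, hi⟩
  have hrn : ∀ n i, m n < i → i ≤ m (n + 1) → r i = if i ∈ B n then 1 else 0 := by
    intro n i h1 h2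
    by_cases hi : i ∈ B n
    · rw [if_pos hi, hr1 n i hi]
    · rw [if_neg hi]
      exact if_neg fun ⟨k, hk⟩ => hi (huniq n k i h1 h2 hk ▸ hk)
  have hsum : ∀ n a c, m n < a → c ≤ m (n + 1) →
      sumDenom r a c = (∑ i ∈ B n with a ≤ i ∧ i ≤ c, (1 : ℚ) / i).den := by
    intro n a c h1 h2
    rw [sumDenom]
    congr 1
    have hset : (B n).filter (fun i => a ≤ i ∧ i ≤ c) = (Finset.Icc a c).filter (· ∈ B n) := by
      ext i
      simp only [Finset.mem_filter, Finset.mem_Icc]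
      tauto
    rw [hset, Finset.sum_filter]
    refine Finset.sum_congr rfl fun i hi => ?_
    have := Finset.mem_Icc.1 hi
    rw [hrn n i (by omega) (by omega)]
    split_ifs <;> simp
  have hlb : ∀ a c, 2 ≤ a → a < c → sumDenom r a c < sumDenom r a (c - 1) →
      Real.log a ≤ 2 * ((c : ℝ) - a) := by
    intro a c ha hac hdrop
    have hc : ∃ n, c ∈ B n := by
      by_contra hc
      exact hdrop.ne (sumDenom_pred (if_neg hc)).symm
    obtain ⟨n, hn⟩ := hc
    have hcn := hlow n c hn
    have ha0 : (0 : ℝ) < a := by exact_mod_cast (by omega : 0 < a)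
    -- If a precedes the gap before the block of c, then c ≥ 2a and log a ≤ a suffices. Otherwise
    -- the whole sum lies in one block.
    rcases le_or_gt a (m n) with hle | hgt
    · have h1 := hstep n
      have h2 : (2 : ℝ) * a ≤ c := by exact_mod_cast (by omega : 2 * a ≤ c)
      linarith [Real.log_le_sub_one_of_pos ha0]
    · rw [hsum n a c hgt hcn.2, hsum n a (c - 1) hgt (by omega)] at hdrop
      have e1 : (B n).filter (fun i => a ≤ i ∧ i ≤ c - 1)
          = (B n).filter (fun i => a ≤ i ∧ i < c) :=
        Finset.filter_congr fun i _ => by omega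
      have e2 : (B n).filter (fun i => a ≤ i ∧ i ≤ c)
          = insert c ((B n).filter fun i => a ≤ i ∧ i < c) := by
        ext i
        simp only [Finset.mem_filter, Finset.mem_insert]
        constructor
        · rintro ⟨h1, h2, h3⟩
          rcases h3.eq_or_lt with h3 | h3
          · exact Or.inl h3
          · exact Or.inr ⟨h1, h2, h3⟩
        · rintro (rfl | ⟨h1, h2, h3⟩)
          · exact ⟨hn, hac.le, le_rfl⟩
          · exact ⟨h1, h2, h3.le⟩
      rw [e1, e2, Finset.sum_insert (by simp), add_comm] at hdrop
      have hK : a + K n ≤ c := by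
        by_contra hcon
        exact absurd ((h n).2.2.2.2.2.2.2 a c hn (by omega)) (not_le.2 hdrop)
      have h1 : Real.log a ≤ Real.log (m (n + 1)) :=
        Real.log_le_log ha0 (by exact_mod_cast (by omega : a ≤ m (n + 1)))
      have h2 : (a : ℝ) + K n ≤ c := by exact_mod_cast hK
      linarith [(h n).2.2.2.2.1]
  have hub : ∀ n, 1 ≤ n →
      dropRatio r (m (n + 1) - K n) ≤ ((1 / 2 + 1 / ((n : ℝ) + 1) : ℝ) : EReal) := by
    intro n hn
    have h1 := hstep n
    have h2 := hmono.id_le n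
    obtain ⟨-, hK, hmem, -, -, hlog, hden, -⟩ := h n
    simp only [id] at h2
    refine dropRatio_le (b := m (n + 1)) (by omega) (by omega) ?_ ?_
    · rw [hsum n _ _ (by omega) le_rfl, hsum n _ _ (by omega) (by omega)]
      convert hden using 4
      · refine Finset.filter_true_of_mem fun i hi => hlow n i hi
      · ext i
        simp only [Finset.mem_filter, Finset.mem_erase]
        constructor
        · rintro ⟨h3, h4, h5⟩
          exact ⟨by omega, h3⟩
        · rintro ⟨h3, h4⟩
          have := hlow n i h4
          exact ⟨h4, by omega, by omega⟩
    · rw [Nat.cast_sub (by omega)] at hlog ⊢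
      linarith
  refine ⟨r, fun i _ => ?_, ?_, ?_⟩
  · by_cases hi : ∃ n, i ∈ B n
    · exact Or.inr (if_pos hi)
    · exact Or.inl (if_neg hi)
  -- The gap after `m (t + 1)` is longer than t, so a shift by t carries the 1 at the block's end to
  -- a 0.
  · rintro ⟨t, ht, hper⟩
    have h1 := hmono.id_le (t + 1)
    have h2 := hstep (t + 1)
    simp only [id] at h1
    have h3 := hper (m (t + 1)) (by omega)
    rw [hr1 t _ (h t).2.2.1, hrn (t + 1) _ (by omega) (by omega), if_neg] at h3
    · exact zero_ne_one h3
    · intro h4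
      have := hlow _ _ h4
      omega
  · refine le_antisymm ?_ ?_
    · refine EReal.le_of_forall_lt_iff_le.1 fun z hz => ?_
      have hz' : (1 / 2 : ℝ) < z := by exact_mod_cast hz
      obtain ⟨N, hN⟩ := exists_nat_one_div_lt (sub_pos.2 hz')
      refine Filter.liminf_le_of_frequently_le' (Filter.frequently_atTop.2 fun a => ?_)
      have h1 := hstep (max N a + 1)
      have h2 := hmono.id_le (max N a + 1)
      simp only [id] at h2
      refine ⟨_, ?_, (hub (max N a + 1) (by omega)).trans ?_⟩
      · omega
      · have h3 : 1 / (((max N a + 1 : ℕ) : ℝ) + 1) ≤ 1 / ((N : ℝ) + 1) := by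
          refine one_div_le_one_div_of_le (by positivity) ?_
          have : N ≤ max N a + 1 := by omega
          have : (N : ℝ) ≤ ((max N a + 1 : ℕ) : ℝ) := by exact_mod_cast this
          linarith
        exact_mod_cast (by linarith : 1 / 2 + 1 / (((max N a + 1 : ℕ) : ℝ) + 1) ≤ z)
    · refine Filter.le_liminf_of_le (by isBoundedDefault) ?_
      filter_upwards [Filter.eventually_ge_atTop 2] with a ha
      exact half_le_dropRatio ha fun c hac hd => hlb a c ha hac hd
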